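/- **Setting.** Consider the control-affine system $\dot q=f(q)+g(q)u$ with $f:\mathbb R^d\to\mathbb R^d$, $g:\mathbb R^d\to\mathbb R^{d\times m}$ locally Lipschitz, inputs $u\in\mathcal U\subset\mathbb R^m$, and a configuration space $\mathcal Q\subset\mathbb R^d$ of finite Lebesgue measure with $\mathcal Q\subset\overline{\operatorname{int}\mathcal Q}$. Let $\mathcal O_1,\dots,\mathcal O_n\subset\mathcal Q$ be obstacles, $\mathcal Q_{safe}=\mathcal Q\setminus\bigcup_i\mathcal O_i$, $q_{start}\in\mathcal Q_{safe}$, $\mathcal Q_{goal}\subset\mathcal Q_{safe}$, and let $C(u,q)>0$ be a running cost. A *motion* is a pair $(u,q)$ on some $[0,T]$, with values in $\mathcal U\times\mathcal Q$, $q$ continuous and solving the system (with right derivatives, so that inputs may jump); its cost is $\int_0^T C(u,q)\,dt$. Let $\mathcal G$ be the set of motions that start at $q_{start}$, stay in $\mathcal Q_{safe}$ and end in $\mathcal Q_{goal}$ ($T=0$ is allowed if $q_{start}\in\mathcal Q_{goal}$). A configuration $y$ is *reachable* from $x$ if some motion in $\mathcal Q$ (obstacles disregarded) leads from $x$ to $y$.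 **Barrier function.** Let $h$ be a high-order control barrier function (HOCBF) of relative degree $\rho\ge1$: with $\psi_0=h$ and $\psi_j=\dot\psi_{j-1}+\alpha_j(\psi_{j-1})$, where $\alpha_1,\dots,\alpha_\rho:\mathbb R\to\mathbb R$ are continuous, strictly increasing and vanish at $0$, the functions $\psi_0,\dots,\psi_{\rho-1}$ are differentiable on $\mathcal Q$, the input appears in $\dot\psi_{\rho-1}$ but in no earlier $\dot\psi_j$, and for every $q\in\mathcal C:=\{q\in\mathcal Q:\psi_0(q),\dots,\psi_{\rho-1}(q)\ge0\}$ some $u\in\mathcal U$ satisfies the HOCBF constraint $$\pounds_f\psi_{\rho-1}(q)+\pounds_g\psi_{\rho-1}(q)u+\alpha_\rho(\psi_{\rho-1}(q))\ge0 .$$ Assume $\mathcal C\subset\mathcal Q_{safe}$ and $q_{start}\in\mathcal C$. **CBF-RRT\*.** The user supplies for all $x,y$ an open-loop input $u_{OL}(t)$, $t\in[0,T_{OL}]$, for steering from $x$ to $y$. The *exploratory planner* follows from $x$ a motion on $[0,T_{OL}]$ whose input at each time $t$ minimizes $\|u-u_{OL}(t)\|^2$ over $u\in\mathcal U$ subject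 to the HOCBF constraint at $q(t)$ (CBF-QP). The *exact planner* from $x$ to $y$, with a user-supplied control Lyapunov function $V_y$ with rate $c_3$ for the equilibrium $y$, returns a motion from $x$ ending exactly at $y$, of duration at most a given bound, whose input at each time is part of a minimizer $(u,\delta)$ of $\|u\|^2+\delta^2$ over $u\in\mathcal U$, $\delta\in\mathbb R$ subject to $\pounds_fV_y+\pounds_gV_y\,u+c_3V_y\le\delta$ and the HOCBF constraint (CLF-CBF-QP). A planner fails if no such motion exists (in the exact case also if $V_y$ is not a control Lyapunov function). The tree starts with the root $q_{start}$. Each iteration takes a sample $s\in\mathcal Q$ and the vertex $v$ nearest to it, lets the target be $s$ if $\|s-v\|<\eta$ and the point at distance $\eta$ from $v$ in the direction of $s$ otherwise, and applies the exploratory planner from $v$ with the open-loop input towards the target. If it fails, the tree is unchanged. Otherwise the end $v_{new}$ of the motion becomes a vertex. With $N_V$ the number of vertices, among $v$ and the vertices within $\min\{\lambda(\log N_V/N_V)^{1/(d+1)},\eta\}$ of $v_{new}$ (joined to it by the exact planner) the one giving the least cost from the root becomes its parent, and then each of these nearby vertices is reconnected to $v_{new}$ by the exact planner if this lowers its cost.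 Finally an extension of $v_{new}$ towards a point of $\mathcal Q_{goal}$ by the exploratory planner may be attempted; it is kept if it ends in $\mathcal Q_{goal}$. **Theorem.** Let $0<\mu<\varepsilon/4$, $0<\iota<\varepsilon/4-\mu$, $\eta=\varepsilon/4+\mu+2\iota$, $\lambda>0$, and assume: 1. (Robust feasibility) There is $\varphi=(u,q)\in\mathcal G$ on $[0,T]$ with $\|q(t)-q_o\|\ge\varepsilon/2$ for all $t\in[0,T]$ and $q_o\in\mathcal Q\setminus\mathcal Q_{safe}$, and for some $r>\mu$ every point of $\mathcal Q_{safe}$ at distance at most $r$ from $q(T)$ lies in $\mathcal Q_{goal}$. 2. (Open-loop steering) For all $x,y\in\mathcal Q$ with $y$ reachable from $x$, the supplied $u_{OL}$ steers the system in $\mathcal Q$ from $x$ to $y$ in time $T_{OL}$, obstacles disregarded; and any two points of $\mathcal Q_{safe}$ at distance at most $\eta$ are reachable from each other in this sense. 3. (Tuning) The HOCBF is tuned such that for all $x\in\mathcal C$ and all $y\in\mathcal Q_{safe}$ reachable from $x$ with $\|x-y\|\le\eta$, the exploratory planner from $x$ with the open-loop input for $y$ succeeds and ends within distance $\mu$ of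 $y$. Then, if the samples are independent and uniformly distributed on $\mathcal Q$, CBF-RRT\* is probabilistically complete: the probability that after $N$ samples the tree contains a branch from the root whose concatenated motion belongs to $\mathcal G$ tends to $1$ as $N\to\infty$ (and the outer probability that it does not tends to $0$). -/

import Mathlib

open Set Filter Topology MeasureTheory ProbabilityTheory
open scoped ENNReal

noncomputable section

/-- Configurations: Euclidean `d`-space. -/
abbrev Cfg (d : ℕ) := EuclideanSpace ℝ (Fin d)

/-- Control inputs: Euclidean `m`-space. -/
abbrev Inp (m : ℕ) := EuclideanSpace ℝ (Fin m)

/-- A pair `(u, q)` of an input and a configuration curve over the time horizon `[0, T]`.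
Values outside `[0, T]` carry no meaning. -/
structure Motion (d m : ℕ) where
  T : ℝ
  u : ℝ → Inp m
  q : ℝ → Cfg d

namespace Motion

variable {d m : ℕ}

/-- The motion of duration zero at `x`. -/
def stay (x : Cfg d) : Motion d m := ⟨0, fun _ => 0, fun _ => x⟩

/-- Concatenation: first `φ`, then `χ`. -/
def append (φ χ : Motion d m) : Motion d m where
  T := φ.T + χ.T
  u := fun t => if t < φ.T then φ.u t else χ.u (t - φ.T)
  q := fun t => if t < φ.T then φ.q t else χ.q (t - φ.T)

/-- The configuration at the end of the motion. -/
def last (φ : Motion d m) : Cfg d := φ.q φ.T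

end Motion

/-- The data of a motion planning problem for the control-affine system `q' = f(q) + g(q) u`. -/
structure PlanningProblem (d m : ℕ) where
  /-- drift -/
  f : Cfg d → Cfg d
  /-- input matrix, as a linear map -/
  g : Cfg d → (Inp m →L[ℝ] Cfg d)
  /-- allowable inputs -/
  U : Set (Inp m)
  /-- configuration space -/
  Q : Set (Cfg d)
  /-- number of obstacles -/
  n : ℕ
  /-- obstacles -/
  O : Fin n → Set (Cfg d)
  qstart : Cfg d
  Qgoal : Set (Cfg d)
  /-- running cost -/
  C : Inp m → Cfg d → ℝ

namespace PlanningProblem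

variable {d m : ℕ} (P : PlanningProblem d m)

/-- The obstacle-free configuration space. -/
def Qsafe : Set (Cfg d) := P.Q \ ⋃ i, P.O i

/-- The standing assumptions on the data. The configuration space, from which one samples
uniformly, is a set of finite volume contained in the closure of its interior. -/
structure Standing : Prop where
  f_lip : LocallyLipschitz P.f
  g_lip : LocallyLipschitz P.g
  obstacle_subset : ∀ i, P.O i ⊆ P.Q
  start_safe : P.qstart ∈ P.Qsafe
  goal_safe : P.Qgoal ⊆ P.Qsafe
  cost_pos : ∀ u ∈ P.U, ∀ q ∈ P.Q, 0 < P.C u q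
  Q_regular : P.Q ⊆ closure (interior P.Q)
  Q_finite : volume P.Q < ∞

/-- `φ` is a pair of an admissible input and a trajectory in `Q` that solves the control system.
The derivative is the right derivative, so that inputs may jump (as piecewise continuous inputs
do) and motions may be concatenated. -/
structure IsMotion (φ : Motion d m) : Prop where
  T_nonneg : 0 ≤ φ.T
  cont : ContinuousOn φ.q (Icc 0 φ.T)
  mem_Q : ∀ t ∈ Icc 0 φ.T, φ.q t ∈ P.Q
  mem_U : ∀ t ∈ Ico 0 φ.T, φ.u t ∈ P.U
  deriv : ∀ t ∈ Ico 0 φ.T,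
    HasDerivWithinAt φ.q (P.f (φ.q t) + P.g (φ.q t) (φ.u t)) (Ici t) t

/-- The solutions of the planning problem: motions in the safe set from the start
configuration to the goal region. -/
def solutions : Set (Motion d m) :=
  {φ | P.IsMotion φ ∧ φ.q 0 = P.qstart ∧ φ.last ∈ P.Qgoal ∧ ∀ t ∈ Icc 0 φ.T, φ.q t ∈ P.Qsafe}

/-- The cost functional, the integral of the (positive) running cost, possibly infinite. -/
def J (φ : Motion d m) : ℝ≥0∞ :=
  ∫⁻ t in Ico 0 φ.T, ENNReal.ofReal (P.C (φ.u t) (φ.q t))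

/-- `φ` keeps distance at least `ε / 2` from every obstacle configuration. -/
def HasClearance (φ : Motion d m) (ε : ℝ) : Prop :=
  ∀ t ∈ Icc 0 φ.T, ∀ x ∈ P.Q \ P.Qsafe, ε / 2 ≤ dist (φ.q t) x

/-- `y` is reachable from `x` in `Q`, the obstacles being disregarded. -/
def Reachable (x y : Cfg d) : Prop :=
  ∃ φ : Motion d m, P.IsMotion φ ∧ φ.q 0 = x ∧ φ.last = y

/-- The Lie derivative of `w` along `f`. -/
def lieF (w : Cfg d → ℝ) (q : Cfg d) : ℝ := fderiv ℝ w q (P.f q)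

/-- The Lie derivative of `w` along `g`, applied to the input `u`. -/
def lieG (w : Cfg d → ℝ) (q : Cfg d) (u : Inp m) : ℝ := fderiv ℝ w q (P.g q u)

/-- Control Lyapunov functions for the equilibrium `x`, with decay rate `c₃`.
The infimum is taken in the extended reals. -/
structure IsCLF (V : Cfg d → ℝ) (x : Cfg d) (c₃ : ℝ) : Prop where
  equilibrium : P.f x = 0
  smooth : ∀ q ∈ P.Q, ContDiffAt ℝ 1 V q
  bounds : ∃ c₁ > 0, ∃ c₂ > 0, ∀ q ∈ P.Q,
    c₁ * ‖q - x‖ ^ 2 ≤ V q ∧ V q ≤ c₂ * ‖q - x‖ ^ 2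
  rate_pos : 0 < c₃
  decay : ∀ q ∈ P.Q,
    (⨅ u ∈ P.U, ((P.lieF V q + P.lieG V q u + c₃ * V q : ℝ) : EReal)) ≤ 0

end PlanningProblem

/-- Class `𝓚` functions, defined on the whole line because they are applied to functions on `Q`
that may take negative values. -/
structure IsClassK (α : ℝ → ℝ) : Prop where
  cont : Continuous α
  mono : StrictMono α
  zero : α 0 = 0

/-- A candidate barrier function `h`, its relative degree `ρ`, and the functions `α 1, …, α ρ`. -/
structure Barrier (d : ℕ) where
  h : Cfg d → ℝ
  ρ : ℕ
  α : ℕ → ℝ → ℝ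

namespace Barrier

variable {d m : ℕ} (B : Barrier d) (P : PlanningProblem d m)

/-- `ψ 0 = h` and `ψ (j + 1) = (ψ j)' + α (j + 1) (ψ j)`, where for `j + 1 < ρ` the derivative
along the system does not involve the input and is the Lie derivative along `f`. -/
def ψ : ℕ → Cfg d → ℝ
  | 0 => B.h
  | j + 1 => fun q => P.lieF (ψ j) q + B.α (j + 1) (ψ j q)

/-- The intersection of the sets `{q ∈ Q | ψ j q ≥ 0}` for `j = 0, …, ρ - 1`. -/
def certified : Set (Cfg d) := {q | q ∈ P.Q ∧ ∀ j < B.ρ, 0 ≤ B.ψ P j q}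

/-- The barrier constraint `(ψ (ρ - 1))' + α ρ (ψ (ρ - 1)) ≥ 0` on the input `u` at `q`. -/
def Constraint (q : Cfg d) (u : Inp m) : Prop :=
  0 ≤ P.lieF (B.ψ P (B.ρ - 1)) q + P.lieG (B.ψ P (B.ρ - 1)) q u
    + B.α B.ρ (B.ψ P (B.ρ - 1) q)

/-- `h` is a high-order control barrier function of relative degree `ρ`, with the class `𝓚`
functions `α 1, …, α ρ`. -/
structure IsHOCBF : Prop where
  rho_pos : 0 < B.ρ
  classK : ∀ j, 1 ≤ j → j ≤ B.ρ → IsClassK (B.α j)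
  smooth : ∀ j < B.ρ, ∀ q ∈ P.Q, DifferentiableAt ℝ (B.ψ P j) q
  /-- the input does not appear in the first `ρ - 1` derivatives … -/
  no_input : ∀ j, j + 1 < B.ρ → ∀ q ∈ P.Q, ∀ u, P.lieG (B.ψ P j) q u = 0
  /-- … and appears in the next one -/
  input : ∃ q ∈ P.Q, ∃ u, P.lieG (B.ψ P (B.ρ - 1)) q u ≠ 0
  feasible : ∀ q ∈ B.certified P, ∃ u ∈ P.U, B.Constraint P q u

/-- `u` solves the CBF-QP at `q` with reference input `uref`. -/
def IsCBFQP (q : Cfg d) (uref u : Inp m) : Prop :=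
  (u ∈ P.U ∧ B.Constraint P q u) ∧
    ∀ w ∈ P.U, B.Constraint P q w → ‖u - uref‖ ^ 2 ≤ ‖w - uref‖ ^ 2

/-- `(u, δ)` is feasible for the CLF-CBF-QP at `q`, with slack `δ` in the Lyapunov constraint. -/
def CLFCBFFeasible (V : Cfg d → ℝ) (c₃ : ℝ) (q : Cfg d) (u : Inp m) (δ : ℝ) : Prop :=
  u ∈ P.U ∧ P.lieF V q + P.lieG V q u + c₃ * V q ≤ δ ∧ B.Constraint P q u

/-- `u` is the input part of a solution of the CLF-CBF-QP at `q` with reference input `uref`. -/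
def IsCLFCBFQP (V : Cfg d → ℝ) (c₃ : ℝ) (q : Cfg d) (uref u : Inp m) : Prop :=
  ∃ δ : ℝ, B.CLFCBFFeasible P V c₃ q u δ ∧
    ∀ (w : Inp m) (δ' : ℝ), B.CLFCBFFeasible P V c₃ q w δ' →
      ‖u - uref‖ ^ 2 + δ ^ 2 ≤ ‖w - uref‖ ^ 2 + δ' ^ 2

end Barrier

/-- An open-loop input with its time horizon. -/
structure OLPlan (m : ℕ) where
  T : ℝ
  u : ℝ → Inp m

/-- The open-loop plan `p` steers the system from `x` to `y`, the obstacles being disregarded. -/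
def OLPlan.Steers {d m : ℕ} (p : OLPlan m) (P : PlanningProblem d m) (x y : Cfg d) : Prop :=
  ∃ φ : Motion d m, P.IsMotion φ ∧ φ.T = p.T ∧ (∀ t ∈ Ico 0 φ.T, φ.u t = p.u t) ∧
    φ.q 0 = x ∧ φ.last = y

/-- What the user of CBF-RRT* supplies. -/
structure Planner {d m : ℕ} (P : PlanningProblem d m) where
  /-- `uOL x y`: the open-loop plan for steering from `x` to `y` -/
  uOL : Cfg d → Cfg d → OLPlan m
  /-- the barrier function and its class `𝓚` functions -/
  B : Barrier d
  /-- `V y`: the Lyapunov function used for steering exactly to `y` -/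
  V : Cfg d → Cfg d → ℝ
  /-- `c₃ y`: the decay rate of `V y` -/
  c₃ : Cfg d → ℝ
  /-- the longest time horizon that the exact planner may use -/
  Tmax : ℝ
  /-- step size -/
  η : ℝ
  /-- constant in the rewiring radius -/
  lam : ℝ
  /-- the goal configuration to which an extension from the given new vertex is attempted;
  `none` if no attempt is made -/
  goalTry : Cfg d → Option P.Qgoal

/-- A tree with vertices `0, …, size - 1` and root `0`. The edge from `parent i` to `i ≠ 0`
carries the motion `edge i`. -/
structure PTree (d m : ℕ) where
  size : ℕ
  cfg : ℕ → Cfg d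
  parent : ℕ → ℕ
  edge : ℕ → Motion d m

namespace PTree

variable {d m : ℕ}

/-- The tree with the single vertex `x`. -/
def root (x : Cfg d) : PTree d m := ⟨1, fun _ => x, fun _ => 0, fun _ => Motion.stay x⟩

/-- Add a vertex at the end of `φ`, as a child of the vertex `p`. -/
def addChild (τ : PTree d m) (p : ℕ) (φ : Motion d m) : PTree d m where
  size := τ.size + 1
  cfg := Function.update τ.cfg τ.size φ.last
  parent := Function.update τ.parent τ.size p
  edge := Function.update τ.edge τ.size φ

/-- Replace the edge into the vertex `i` by the edge `φ` from the vertex `p`. -/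
def reconnect (τ : PTree d m) (i p : ℕ) (φ : Motion d m) : PTree d m where
  size := τ.size
  cfg := τ.cfg
  parent := Function.update τ.parent i p
  edge := Function.update τ.edge i φ

/-- `φ` is the concatenation of the edges along the branch from the root to the vertex `i`. -/
inductive IsBranch (τ : PTree d m) : ℕ → Motion d m → Prop
  | root : IsBranch τ 0 (Motion.stay (τ.cfg 0))
  | step (i : ℕ) (φ : Motion d m) : i ≠ 0 → i < τ.size → IsBranch τ (τ.parent i) φ →
      IsBranch τ i (φ.append (τ.edge i))

/-- The cost of the branch from the root to the vertex `i`. (There is only one such branch; the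
infimum merely selects it.) -/
def cToCome (P : PlanningProblem d m) (τ : PTree d m) (i : ℕ) : ℝ≥0∞ :=
  ⨅ (φ : Motion d m) (_ : τ.IsBranch i φ), P.J φ

open Classical in
/-- The vertex nearest to `s`, the one with the smallest index in case of a tie. -/
def nearest (τ : PTree d m) (s : Cfg d) : ℕ :=
  if H : ∃ i, i < τ.size ∧ ∀ j < τ.size, dist (τ.cfg i) s ≤ dist (τ.cfg j) s then Nat.find H
  else 0

open Classical in
/-- The vertices within distance `r` of `x`. -/
def near (τ : PTree d m) (r : ℝ) (x : Cfg d) : List ℕ :=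
  (List.range τ.size).filter (fun i => dist (τ.cfg i) x ≤ r)

/-- The tree contains a solution of the planning problem. -/
def HasSolution (P : PlanningProblem d m) (τ : PTree d m) : Prop :=
  ∃ i < τ.size, ∃ φ : Motion d m, τ.IsBranch i φ ∧ φ ∈ P.solutions

end PTree

/-- The configuration towards which one steers from `v` when `s` has been sampled: `s` itself if
it is closer than `η`, otherwise the point at distance `η` from `v` in the direction of `s`. -/
def steerTarget {d : ℕ} (η : ℝ) (v s : Cfg d) : Cfg d :=
  if ‖s - v‖ < η then s else v + (η / ‖s - v‖) • (s - v)

namespace Planner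

variable {d m : ℕ} {P : PlanningProblem d m} (A : Planner P)

/-- The trajectories that the exploratory planner may produce from `v`: over the horizon of the
open-loop plan `p`, the input at each time solves the CBF-QP with the open-loop input as
reference. -/
def IsExploratory (v : Cfg d) (p : OLPlan m) (φ : Motion d m) : Prop :=
  P.IsMotion φ ∧ φ.T = p.T ∧ φ.q 0 = v ∧
    ∀ t ∈ Ico 0 φ.T, A.B.IsCBFQP P (φ.q t) (p.u t) (φ.u t)

/-- The trajectories that the exact planner may produce: they steer exactly from `v` to `w`, and
the input at each time solves the CLF-CBF-QP with reference input zero. -/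
def IsExact (v w : Cfg d) (φ : Motion d m) : Prop :=
  P.IsCLF (A.V w) w (A.c₃ w) ∧ P.IsMotion φ ∧ φ.T ≤ A.Tmax ∧ φ.q 0 = v ∧ φ.last = w ∧
    ∀ t ∈ Ico 0 φ.T, A.B.IsCLFCBFQP P (A.V w) (A.c₃ w) (φ.q t) 0 (φ.u t)

open Classical in
/-- The exploratory local planner; it fails if there is no trajectory as required. -/
def expLPlanning (v : Cfg d) (p : OLPlan m) : Option (Motion d m) :=
  if H : ∃ φ, A.IsExploratory v p φ then some H.choose else none

open Classical in
/-- The exact local planner; it fails if there is no trajectory as required. -/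
def extLPlanning (v w : Cfg d) : Option (Motion d m) :=
  if H : ∃ φ, A.IsExact v w φ then some H.choose else none

/-- The rewiring radius for a tree with `n` vertices. -/
def radius (n : ℕ) : ℝ :=
  min (A.lam * (Real.log n / n) ^ ((1 : ℝ) / (d + 1))) A.η

open Classical in
/-- The best parent of the new vertex `x`, with the connecting motion, among the vertices in the
list `l` and the vertex and motion in `b`. -/
def chooseParent (τ : PTree d m) (x : Cfg d) (l : List ℕ) (b : ℕ × Motion d m) :
    ℕ × Motion d m :=
  l.foldl (fun b i => match A.extLPlanning (τ.cfg i) x with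
    | none => b
    | some χ =>
      if τ.cToCome P i + P.J χ < τ.cToCome P b.1 + P.J b.2 then (i, χ) else b) b

open Classical in
/-- Rewire those vertices in the list `l` whose cost decreases if they are reached through the
vertex `k`. -/
def rewire (τ : PTree d m) (k : ℕ) (l : List ℕ) : PTree d m :=
  l.foldl (fun σ i => match A.extLPlanning (σ.cfg k) (σ.cfg i) with
    | none => σ
    | some χ =>
      if σ.cToCome P k + P.J χ < σ.cToCome P i then σ.reconnect i k χ else σ) τ

open Classical in
/-- Attempt to extend the vertex `k` to the goal region with the exploratory planner. -/
def extToGoal (τ : PTree d m) (k : ℕ) : PTree d m :=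
  match A.goalTry (τ.cfg k) with
  | none => τ
  | some y => match A.expLPlanning (τ.cfg k) (A.uOL (τ.cfg k) y) with
    | none => τ
    | some χ => if χ.last ∈ P.Qgoal then τ.addChild k χ else τ

/-- One iteration of CBF-RRT* with the sample `s`. -/
def step (τ : PTree d m) (s : Cfg d) : PTree d m :=
  let i := τ.nearest s
  let v := τ.cfg i
  match A.expLPlanning v (A.uOL v (steerTarget A.η v s)) with
  | none => τ
  | some φ =>
    let l := τ.near (A.radius (τ.size + 1)) φ.last
    let b := A.chooseParent τ φ.last l (i, φ)
    A.extToGoal (A.rewire (τ.addChild b.1 b.2) τ.size l) τ.size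

/-- The tree that CBF-RRT* has built from the first `N` samples of the sequence `s`. -/
def tree (s : ℕ → Cfg d) : ℕ → PTree d m
  | 0 => PTree.root P.qstart
  | N + 1 => A.step (tree s N) (s N)

end Planner

end

/-! ### Forward invariance of the certified set -/

/-- A function that starts nonnegative and has right derivative at least `-α w` stays
nonnegative. -/
theorem IsClassK.nonneg_of_deriv_right_ge {α : ℝ → ℝ} (hα : IsClassK α) {w w' : ℝ → ℝ} {a b : ℝ}
    (hw : ContinuousOn w (Icc a b))
    (hw' : ∀ t ∈ Ico a b, HasDerivWithinAt w (w' t) (Ici t) t)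
    (hbound : ∀ t ∈ Ico a b, -α (w t) ≤ w' t) (ha : 0 ≤ w a) :
    ∀ t ∈ Icc a b, 0 ≤ w t := by
  intro t ht
  refine le_of_forall_pos_le_add fun δ hδ => ?_
  have key := image_le_of_deriv_right_lt_deriv_boundary' (f := fun t => -w t)
    (f' := fun t => -w' t) hw.neg (fun t ht => (hw' t ht).neg) (B := fun _ => δ)
    (B' := fun _ => 0) (by show -w a ≤ δ; linarith) continuousOn_const
    (fun t _ => hasDerivWithinAt_const ..) (fun t ht h => by
      have h1 := hbound t ht
      have h2 : α (w t) < 0 := by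
        rw [← hα.zero]
        exact hα.mono (by linarith)
      show -w' t < 0
      linarith) ht
  linarith

theorem Barrier.IsHOCBF.mem_certified {d m : ℕ} {P : PlanningProblem d m} {B : Barrier d}
    (hB : B.IsHOCBF P) {φ : Motion d m} (hφ : P.IsMotion φ) (h0 : φ.q 0 ∈ B.certified P)
    (hu : ∀ t ∈ Ico 0 φ.T, B.Constraint P (φ.q t) (φ.u t)) :
    ∀ t ∈ Icc 0 φ.T, φ.q t ∈ B.certified P := by
  have hcont : ∀ j < B.ρ, ContinuousOn (fun t => B.ψ P j (φ.q t)) (Icc 0 φ.T) := fun j hj t ht =>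
    (hB.smooth j hj _ (hφ.mem_Q t ht)).continuousAt.comp_continuousWithinAt (hφ.cont t ht)
  have hderiv : ∀ j < B.ρ, ∀ t ∈ Ico 0 φ.T, HasDerivWithinAt (fun t => B.ψ P j (φ.q t))
      (P.lieF (B.ψ P j) (φ.q t) + P.lieG (B.ψ P j) (φ.q t) (φ.u t)) (Ici t) t := by
    intro j hj t ht
    have h := (hB.smooth j hj _
      (hφ.mem_Q t (Ico_subset_Icc_self ht))).hasFDerivAt.comp_hasDerivWithinAt t (hφ.deriv t ht)
    rwa [map_add] at h
  have hpos : ∀ k j, j + k + 1 = B.ρ → ∀ t ∈ Icc 0 φ.T, 0 ≤ B.ψ P j (φ.q t) := by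
    intro k
    induction k with
    | zero =>
      intro j hj
      obtain rfl : j = B.ρ - 1 := by omega
      have hlt : B.ρ - 1 < B.ρ := by omega
      refine (hB.classK B.ρ hB.rho_pos le_rfl).nonneg_of_deriv_right_ge (hcont _ hlt)
        (hderiv _ hlt) (fun t ht => ?_) (h0.2 _ hlt)
      have := hu t ht
      unfold Barrier.Constraint at this
      linarith
    | succ k ih =>
      intro j hj
      have hlt : j < B.ρ := by omega
      refine (hB.classK (j + 1) (by omega) (by omega)).nonneg_of_deriv_right_ge (hcont _ hlt)
        (hderiv _ hlt) (fun t ht => ?_) (h0.2 _ hlt)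
      have ht' := Ico_subset_Icc_self ht
      have h1 : 0 ≤ P.lieF (B.ψ P j) (φ.q t) + B.α (j + 1) (B.ψ P j (φ.q t)) :=
        ih (j + 1) (by omega) t ht'
      rw [hB.no_input j (by omega) _ (hφ.mem_Q t ht')]
      linarith
  exact fun t ht => ⟨hφ.mem_Q t ht, fun j hj => hpos (B.ρ - 1 - j) j (by omega) t ht⟩

/-! ### Motions -/

theorem PlanningProblem.isMotion_stay {d m : ℕ} {P : PlanningProblem d m} {x : Cfg d}
    (hx : x ∈ P.Q) : P.IsMotion (Motion.stay x) where
  T_nonneg := le_rfl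
  cont := continuousOn_const
  mem_Q := fun _ _ => hx
  mem_U := fun _ ht => absurd (ht.1.trans_lt ht.2) (lt_irrefl _)
  deriv := fun _ ht => absurd (ht.1.trans_lt ht.2) (lt_irrefl _)

namespace Motion

variable {d m : ℕ} {φ χ : Motion d m}

theorem append_q_of_le (h : χ.q 0 = φ.last) {t : ℝ} (ht : t ≤ φ.T) :
    (φ.append χ).q t = φ.q t := by
  rcases ht.lt_or_eq with ht | rfl
  · exact if_pos ht
  · show (if φ.T < φ.T then φ.q φ.T else χ.q (φ.T - φ.T)) = _
    rw [if_neg (lt_irrefl _), sub_self, h, last]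

theorem append_q_of_ge {t : ℝ} (ht : φ.T ≤ t) : (φ.append χ).q t = χ.q (t - φ.T) :=
  if_neg ht.not_gt

theorem append_u_of_lt {t : ℝ} (ht : t < φ.T) : (φ.append χ).u t = φ.u t :=
  if_pos ht

theorem append_u_of_ge {t : ℝ} (ht : φ.T ≤ t) : (φ.append χ).u t = χ.u (t - φ.T) :=
  if_neg ht.not_gt

theorem append_last (hT : 0 ≤ χ.T) : (φ.append χ).last = χ.last := by
  show (φ.append χ).q (φ.T + χ.T) = χ.q χ.T
  rw [append_q_of_ge (by linarith), add_sub_cancel_left]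

end Motion

theorem PlanningProblem.IsMotion.append {d m : ℕ} {P : PlanningProblem d m} {φ χ : Motion d m}
    (hφ : P.IsMotion φ) (hχ : P.IsMotion χ) (h : χ.q 0 = φ.last) : P.IsMotion (φ.append χ) where
  T_nonneg := add_nonneg hφ.T_nonneg hχ.T_nonneg
  cont := by
    have h1 : ContinuousOn (φ.append χ).q (Icc 0 φ.T) :=
      hφ.cont.congr fun t ht => Motion.append_q_of_le h ht.2
    have h2 : ContinuousOn (φ.append χ).q (Icc φ.T (φ.T + χ.T)) := by
      refine ContinuousOn.congr (f := fun t => χ.q (t - φ.T)) ?_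
        fun t ht => Motion.append_q_of_ge ht.1
      exact hχ.cont.comp (by fun_prop) fun t ht => ⟨by linarith [ht.1], by linarith [ht.2]⟩
    have h3 := h1.union_of_isClosed h2 isClosed_Icc isClosed_Icc
    rwa [Icc_union_Icc_eq_Icc hφ.T_nonneg (by linarith [hχ.T_nonneg])] at h3
  mem_Q := by
    intro t ht
    rcases le_total t φ.T with hle | hle
    · rw [Motion.append_q_of_le h hle]
      exact hφ.mem_Q t ⟨ht.1, hle⟩
    · rw [Motion.append_q_of_ge hle]
      exact hχ.mem_Q _ ⟨by linarith, by have : t ≤ φ.T + χ.T := ht.2; linarith⟩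
  mem_U := by
    intro t ht
    rcases lt_or_ge t φ.T with hlt | hle
    · rw [Motion.append_u_of_lt hlt]
      exact hφ.mem_U t ⟨ht.1, hlt⟩
    · rw [Motion.append_u_of_ge hle]
      exact hχ.mem_U _ ⟨by linarith, by have : t < φ.T + χ.T := ht.2; linarith⟩
  deriv := by
    intro t ht
    rcases lt_or_ge t φ.T with hlt | hle
    · rw [Motion.append_q_of_le h hlt.le, Motion.append_u_of_lt hlt]
      refine (hφ.deriv t ⟨ht.1, hlt⟩).congr_of_eventuallyEq ?_ (Motion.append_q_of_le h hlt.le)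
      filter_upwards [mem_nhdsWithin_of_mem_nhds (Iio_mem_nhds hlt)] with s hs
      exact Motion.append_q_of_le h (le_of_lt hs)
    · rw [Motion.append_q_of_ge hle, Motion.append_u_of_ge hle]
      have ht' : t < φ.T + χ.T := ht.2
      have hd := hχ.deriv (t - φ.T) ⟨by linarith, by linarith⟩
      have hs : HasDerivWithinAt (fun s : ℝ => s - φ.T) 1 (Ici t) t :=
        (hasDerivWithinAt_id t _).sub_const _
      have hc := HasDerivWithinAt.scomp t hd hs
        (fun s (hs : t ≤ s) => show t - φ.T ≤ s - φ.T by linarith)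
      rw [one_smul] at hc
      exact hc.congr (fun s (hs : t ≤ s) => Motion.append_q_of_ge (hle.trans hs))
        (Motion.append_q_of_ge hle)

theorem PlanningProblem.J_le_J_append {d m : ℕ} (P : PlanningProblem d m) {φ χ : Motion d m}
    (hT : 0 ≤ χ.T) : P.J φ ≤ P.J (φ.append χ) := by
  have h : P.J φ =
      ∫⁻ t in Ico 0 φ.T, ENNReal.ofReal (P.C ((φ.append χ).u t) ((φ.append χ).q t)) := by
    refine setLIntegral_congr_fun measurableSet_Ico fun t ht => ?_
    show _ = ENNReal.ofReal (P.C (if t < φ.T then _ else _) (if t < φ.T then _ else _))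
    rw [if_pos ht.2, if_pos ht.2]
  rw [h]
  exact lintegral_mono_set (Ico_subset_Ico_right (by show φ.T ≤ φ.T + χ.T; linarith))

/-- `φ` is a motion from `x` to `y` inside the certified set of the barrier function `B`. -/
structure Barrier.Certifies {d m : ℕ} (B : Barrier d) (P : PlanningProblem d m) (x y : Cfg d)
    (φ : Motion d m) : Prop where
  isMotion : P.IsMotion φ
  start : φ.q 0 = x
  last : φ.last = y
  mem : ∀ t ∈ Icc 0 φ.T, φ.q t ∈ B.certified P

namespace Barrier.Certifies

variable {d m : ℕ} {B : Barrier d} {P : PlanningProblem d m} {x y z : Cfg d} {φ χ : Motion d m}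

theorem last_mem (h : B.Certifies P x y φ) : y ∈ B.certified P :=
  h.last ▸ h.mem φ.T ⟨h.isMotion.T_nonneg, le_rfl⟩

theorem stay (hx : x ∈ B.certified P) : B.Certifies P x x (Motion.stay x) :=
  ⟨PlanningProblem.isMotion_stay hx.1, rfl, rfl, fun _ _ => hx⟩

theorem append (h : B.Certifies P x y φ) (h' : B.Certifies P y z χ) :
    B.Certifies P x z (φ.append χ) := by
  have hq : χ.q 0 = φ.last := h'.start.trans h.last.symm
  refine ⟨h.isMotion.append h'.isMotion hq, ?_, ?_, fun t ht => ?_⟩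
  · rw [Motion.append_q_of_le hq h.isMotion.T_nonneg, h.start]
  · rw [Motion.append_last h'.isMotion.T_nonneg, h'.last]
  · have ht' : t ≤ φ.T + χ.T := ht.2
    rcases le_total t φ.T with hle | hle
    · rw [Motion.append_q_of_le hq hle]
      exact h.mem t ⟨ht.1, hle⟩
    · rw [Motion.append_q_of_ge hle]
      exact h'.mem _ ⟨by linarith, by linarith⟩

end Barrier.Certifies

namespace Planner

variable {d m : ℕ} {P : PlanningProblem d m} {A : Planner P}

theorem isExploratory_of_expLPlanning {v : Cfg d} {p : OLPlan m} {φ : Motion d m}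
    (h : A.expLPlanning v p = some φ) : A.IsExploratory v p φ := by
  unfold expLPlanning at h
  split_ifs at h with H
  exact Option.some.inj h ▸ H.choose_spec

theorem isExact_of_extLPlanning {v w : Cfg d} {φ : Motion d m}
    (h : A.extLPlanning v w = some φ) : A.IsExact v w φ := by
  unfold extLPlanning at h
  split_ifs at h with H
  exact Option.some.inj h ▸ H.choose_spec

theorem certifies_of_expLPlanning (hB : A.B.IsHOCBF P) {v : Cfg d} {p : OLPlan m}
    {φ : Motion d m} (hv : v ∈ A.B.certified P) (h : A.expLPlanning v p = some φ) :
    A.B.Certifies P v φ.last φ := by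
  obtain ⟨hm, -, h0, hu⟩ := isExploratory_of_expLPlanning h
  exact ⟨hm, h0, rfl, hB.mem_certified hm (h0 ▸ hv) fun t ht => (hu t ht).1.2⟩

theorem certifies_of_extLPlanning (hB : A.B.IsHOCBF P) {v w : Cfg d} {φ : Motion d m}
    (hv : v ∈ A.B.certified P) (h : A.extLPlanning v w = some φ) :
    A.B.Certifies P v w φ := by
  obtain ⟨-, hm, -, h0, hl, hu⟩ := isExact_of_extLPlanning h
  refine ⟨hm, h0, hl, hB.mem_certified hm (h0 ▸ hv) fun t ht => ?_⟩
  obtain ⟨δ, hδ, -⟩ := hu t ht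
  exact hδ.2.2

end Planner

/-! ### Trees -/

namespace PTree

variable {d m : ℕ}

/-- Every vertex is joined to the root, which is the start configuration, by a branch, and every
edge carries a motion inside the certified set. -/
structure Valid (P : PlanningProblem d m) (B : Barrier d) (τ : PTree d m) : Prop where
  size_pos : 0 < τ.size
  root_eq : τ.cfg 0 = P.qstart
  mem : ∀ i < τ.size, τ.cfg i ∈ B.certified P
  parent_lt : ∀ i < τ.size, i ≠ 0 → τ.parent i < τ.size
  edge : ∀ i < τ.size, i ≠ 0 → B.Certifies P (τ.cfg (τ.parent i)) (τ.cfg i) (τ.edge i)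
  branch : ∀ i < τ.size, ∃ φ, τ.IsBranch i φ

/-- `σ` has at least the vertices of `τ`, at the same places. -/
def Extends (τ σ : PTree d m) : Prop :=
  τ.size ≤ σ.size ∧ ∀ i < τ.size, σ.cfg i = τ.cfg i

theorem Extends.refl (τ : PTree d m) : τ.Extends τ := ⟨le_rfl, fun _ _ => rfl⟩

theorem Extends.trans {τ σ υ : PTree d m} (h : τ.Extends σ) (h' : σ.Extends υ) : τ.Extends υ :=
  ⟨h.1.trans h'.1, fun i hi => (h'.2 i (hi.trans_le h.1)).trans (h.2 i hi)⟩

theorem extends_addChild (τ : PTree d m) (p : ℕ) (φ : Motion d m) :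
    τ.Extends (τ.addChild p φ) :=
  ⟨Nat.le_succ _, fun _ hi => Function.update_of_ne hi.ne _ _⟩

theorem addChild_cfg_size (τ : PTree d m) (p : ℕ) (φ : Motion d m) :
    (τ.addChild p φ).cfg τ.size = φ.last :=
  Function.update_self ..

theorem nearest_spec {τ : PTree d m} (hτ : 0 < τ.size) (s : Cfg d) :
    τ.nearest s < τ.size ∧ ∀ j < τ.size, dist (τ.cfg (τ.nearest s)) s ≤ dist (τ.cfg j) s := by
  classical
  have H : ∃ i, i < τ.size ∧ ∀ j < τ.size, dist (τ.cfg i) s ≤ dist (τ.cfg j) s := by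
    obtain ⟨i, hi, hmin⟩ := Finset.exists_min_image (Finset.range τ.size)
      (fun i => dist (τ.cfg i) s) ⟨0, Finset.mem_range.2 hτ⟩
    exact ⟨i, Finset.mem_range.1 hi, fun j hj => hmin j (Finset.mem_range.2 hj)⟩
  rw [nearest, dif_pos H]
  exact Nat.find_spec H

theorem lt_size_of_mem_near {τ : PTree d m} {r : ℝ} {x : Cfg d} {i : ℕ} (h : i ∈ τ.near r x) :
    i < τ.size :=
  List.mem_range.1 (List.mem_of_mem_filter h)

theorem valid_root {P : PlanningProblem d m} {B : Barrier d} (h : P.qstart ∈ B.certified P) :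
    (root P.qstart).Valid P B where
  size_pos := Nat.one_pos
  root_eq := rfl
  mem := fun _ _ => h
  parent_lt := fun _ _ _ => Nat.one_pos
  edge := fun _ _ _ => Barrier.Certifies.stay h
  branch := fun i hi => by
    obtain rfl : i = 0 := Nat.lt_one_iff.1 hi
    exact ⟨_, IsBranch.root⟩

namespace Valid

variable {P : PlanningProblem d m} {B : Barrier d} {τ : PTree d m}

theorem certifies_of_isBranch (hτ : τ.Valid P B) {i : ℕ} {φ : Motion d m}
    (h : τ.IsBranch i φ) : B.Certifies P P.qstart (τ.cfg i) φ := by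
  induction h with
  | root => exact hτ.root_eq ▸ Barrier.Certifies.stay (hτ.mem 0 hτ.size_pos)
  | step i φ hi hlt _ ih => exact ih.append (hτ.edge i hlt hi)

theorem hasSolution (hτ : τ.Valid P B) (hB : B.certified P ⊆ P.Qsafe) {i : ℕ} (hi : i < τ.size)
    (hgoal : τ.cfg i ∈ P.Qgoal) : τ.HasSolution P := by
  obtain ⟨φ, hφ⟩ := hτ.branch i hi
  have h := hτ.certifies_of_isBranch hφ
  exact ⟨i, hi, φ, hφ, h.isMotion, h.start, h.last ▸ hgoal, fun t ht => hB (h.mem t ht)⟩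

theorem addChild (hτ : τ.Valid P B) {p : ℕ} (hp : p < τ.size) {χ : Motion d m}
    (hχ : B.Certifies P (τ.cfg p) χ.last χ) : (τ.addChild p χ).Valid P B := by
  have hcfg : ∀ i < τ.size, (τ.addChild p χ).cfg i = τ.cfg i := (τ.extends_addChild p χ).2
  have hpar : ∀ i < τ.size, (τ.addChild p χ).parent i = τ.parent i :=
    fun i hi => Function.update_of_ne hi.ne _ _
  have hedge : ∀ i < τ.size, (τ.addChild p χ).edge i = τ.edge i :=
    fun i hi => Function.update_of_ne hi.ne _ _
  have hcfg' : (τ.addChild p χ).cfg τ.size = χ.last := τ.addChild_cfg_size p χ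
  have hpar' : (τ.addChild p χ).parent τ.size = p := Function.update_self ..
  have hedge' : (τ.addChild p χ).edge τ.size = χ := Function.update_self ..
  have hbr : ∀ i φ, τ.IsBranch i φ → (τ.addChild p χ).IsBranch i φ := by
    intro i φ h
    induction h with
    | root =>
      rw [← hcfg 0 hτ.size_pos]
      exact IsBranch.root
    | step i φ hi hlt _ ih =>
      rw [← hpar i hlt] at ih
      rw [← hedge i hlt]
      exact IsBranch.step i φ hi (Nat.lt_succ_of_lt hlt) ih
  have hsize : ∀ i, i < (τ.addChild p χ).size → i < τ.size ∨ i = τ.size :=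
    fun i hi => Nat.lt_succ_iff_lt_or_eq.1 hi
  refine ⟨Nat.succ_pos _, (hcfg 0 hτ.size_pos).trans hτ.root_eq, fun i hi => ?_,
    fun i hi h0 => ?_, fun i hi h0 => ?_, fun i hi => ?_⟩
  · rcases hsize i hi with h | rfl
    · exact (hcfg i h).symm ▸ hτ.mem i h
    · exact hcfg'.symm ▸ hχ.last_mem
  · rcases hsize i hi with h | rfl
    · exact (hpar i h).symm ▸ Nat.lt_succ_of_lt (hτ.parent_lt i h h0)
    · exact hpar'.symm ▸ Nat.lt_succ_of_lt hp
  · rcases hsize i hi with h | rfl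
    · rw [hpar i h, hcfg i h, hedge i h, hcfg _ (hτ.parent_lt i h h0)]
      exact hτ.edge i h h0
    · rw [hpar', hcfg', hedge', hcfg p hp]
      exact hχ
  · rcases hsize i hi with h | rfl
    · obtain ⟨φ, hφ⟩ := hτ.branch i h
      exact ⟨φ, hbr i φ hφ⟩
    · obtain ⟨φ, hφ⟩ := hτ.branch p hp
      refine ⟨_, IsBranch.step τ.size φ hτ.size_pos.ne' (Nat.lt_succ_self _) ?_⟩
      rw [hpar']
      exact hbr p φ hφ

/-- A branch to `k` that is cheaper than the vertex `i` does not pass through `i`, so it survives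
a reconnection of `i`. -/
theorem isBranch_reconnect_of_lt (hτ : τ.Valid P B) {i p : ℕ} {χ : Motion d m} {k : ℕ}
    {φ : Motion d m} (h : τ.IsBranch k φ) (hlt : P.J φ < τ.cToCome P i) :
    (τ.reconnect i p χ).IsBranch k φ := by
  induction h with
  | root => exact IsBranch.root (τ := τ.reconnect i p χ)
  | step k φ hk hks hb ih =>
    have hki : k ≠ i := by
      rintro rfl
      exact hlt.not_ge (iInf₂_le _ (IsBranch.step k φ hk hks hb))
    have hpar : (τ.reconnect i p χ).parent k = τ.parent k := Function.update_of_ne hki _ _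
    have hedge : (τ.reconnect i p χ).edge k = τ.edge k := Function.update_of_ne hki _ _
    have ih := ih ((P.J_le_J_append (hτ.edge k hks hk).isMotion.T_nonneg).trans_lt hlt)
    rw [← hpar] at ih
    rw [← hedge]
    exact IsBranch.step k φ hk hks ih

theorem reconnect (hτ : τ.Valid P B) {i k : ℕ} (hi : i < τ.size) (hk : k < τ.size)
    {χ : Motion d m} (hχ : B.Certifies P (τ.cfg k) (τ.cfg i) χ)
    (hlt : τ.cToCome P k < τ.cToCome P i) : (τ.reconnect i k χ).Valid P B := by
  have hpar : ∀ j, j ≠ i → (τ.reconnect i k χ).parent j = τ.parent j :=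
    fun j hj => Function.update_of_ne hj _ _
  have hedge : ∀ j, j ≠ i → (τ.reconnect i k χ).edge j = τ.edge j :=
    fun j hj => Function.update_of_ne hj _ _
  have hpar' : (τ.reconnect i k χ).parent i = k := Function.update_self ..
  have hedge' : (τ.reconnect i k χ).edge i = χ := Function.update_self ..
  have hi0 : i ≠ 0 := by
    rintro rfl
    have h0 : τ.cToCome P 0 ≤ 0 := by
      refine (iInf₂_le _ IsBranch.root).trans (le_of_eq ?_)
      simp [PlanningProblem.J, Motion.stay]
    exact (hlt.trans_le h0).not_ge zero_le
  have hbri : ∃ φ, (τ.reconnect i k χ).IsBranch i φ := by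
    unfold cToCome at hlt
    obtain ⟨φ, hφ⟩ := iInf_lt_iff.1 hlt
    obtain ⟨hb, hφ⟩ := iInf_lt_iff.1 hφ
    refine ⟨_, IsBranch.step i φ hi0 hi ?_⟩
    rw [hpar']
    exact hτ.isBranch_reconnect_of_lt hb hφ
  have hbr : ∀ j φ, τ.IsBranch j φ → ∃ φ', (τ.reconnect i k χ).IsBranch j φ' := by
    intro j φ h
    induction h with
    | root => exact ⟨_, IsBranch.root⟩
    | step j φ hj hjs _ ih =>
      by_cases hji : j = i
      · exact hji ▸ hbri
      · obtain ⟨φ', h'⟩ := ih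
        rw [← hpar j hji] at h'
        exact ⟨_, IsBranch.step j φ' hj hjs h'⟩
  refine ⟨hτ.size_pos, hτ.root_eq, hτ.mem, fun j hj h0 => ?_, fun j hj h0 => ?_, fun j hj => ?_⟩
  · by_cases hji : j = i
    · rw [hji, hpar']
      exact hk
    · rw [hpar j hji]
      exact hτ.parent_lt j hj h0
  · by_cases hji : j = i
    · rw [hji, hpar', hedge']
      exact hχ
    · rw [hpar j hji, hedge j hji]
      exact hτ.edge j hj h0
  · obtain ⟨φ, hφ⟩ := hτ.branch j hj
    exact hbr j φ hφ

end Valid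

end PTree

/-! ### The algorithm -/

namespace Planner

variable {d m : ℕ} {P : PlanningProblem d m} {A : Planner P} {τ : PTree d m}

theorem chooseParent_spec (hB : A.B.IsHOCBF P) (hτ : τ.Valid P A.B) {x : Cfg d} {l : List ℕ}
    (hl : ∀ i ∈ l, i < τ.size) {b : ℕ × Motion d m} (hb : b.1 < τ.size)
    (hb' : A.B.Certifies P (τ.cfg b.1) x b.2) :
    (A.chooseParent τ x l b).1 < τ.size ∧
      A.B.Certifies P (τ.cfg (A.chooseParent τ x l b).1) x (A.chooseParent τ x l b).2 := by
  classical
  unfold chooseParent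
  induction l generalizing b with
  | nil => exact ⟨hb, hb'⟩
  | cons i l ih =>
    rw [List.foldl_cons]
    have hi : i < τ.size := hl i List.mem_cons_self
    have ih' := fun {b} => @ih (fun j hj => hl j (List.mem_cons_of_mem _ hj)) b
    rcases hχ : A.extLPlanning (τ.cfg i) x with _ | χ
    · exact ih' hb hb'
    · dsimp only
      split_ifs
      · exact ih' hi (certifies_of_extLPlanning hB (hτ.mem i hi) hχ)
      · exact ih' hb hb'

theorem rewire_spec (hB : A.B.IsHOCBF P) (hτ : τ.Valid P A.B) {k : ℕ} (hk : k < τ.size)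
    {l : List ℕ} (hl : ∀ i ∈ l, i < τ.size) :
    (A.rewire τ k l).Valid P A.B ∧ τ.Extends (A.rewire τ k l) := by
  classical
  unfold rewire
  induction l generalizing τ with
  | nil => exact ⟨hτ, PTree.Extends.refl τ⟩
  | cons i l ih =>
    rw [List.foldl_cons]
    have hi : i < τ.size := hl i List.mem_cons_self
    have hl' : ∀ j ∈ l, j < τ.size := fun j hj => hl j (List.mem_cons_of_mem _ hj)
    rcases hχ : A.extLPlanning (τ.cfg k) (τ.cfg i) with _ | χ
    · exact ih hτ hk hl'
    · dsimp only
      split_ifs with hlt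
      · exact ih (τ := τ.reconnect i k χ) (hτ.reconnect hi hk
          (certifies_of_extLPlanning hB (hτ.mem k hk) hχ) (le_self_add.trans_lt hlt)) hk hl'
      · exact ih hτ hk hl'

theorem extToGoal_spec (hB : A.B.IsHOCBF P) (hτ : τ.Valid P A.B) {k : ℕ} (hk : k < τ.size) :
    (A.extToGoal τ k).Valid P A.B ∧ τ.Extends (A.extToGoal τ k) := by
  classical
  have h0 : τ.Valid P A.B ∧ τ.Extends τ := ⟨hτ, PTree.Extends.refl τ⟩
  unfold extToGoal
  rcases A.goalTry (τ.cfg k) with _ | y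
  · exact h0
  · dsimp only
    rcases hχ : A.expLPlanning (τ.cfg k) (A.uOL (τ.cfg k) y) with _ | χ
    · exact h0
    · dsimp only
      split_ifs
      · exact ⟨hτ.addChild hk (certifies_of_expLPlanning hB (hτ.mem k hk) hχ),
          τ.extends_addChild k χ⟩
      · exact h0

theorem step_spec (hB : A.B.IsHOCBF P) (hτ : τ.Valid P A.B) (s : Cfg d) :
    (A.step τ s).Valid P A.B ∧ τ.Extends (A.step τ s) ∧
      ∀ φ, A.expLPlanning (τ.cfg (τ.nearest s))
          (A.uOL (τ.cfg (τ.nearest s)) (steerTarget A.η (τ.cfg (τ.nearest s)) s)) = some φ →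
        ∃ i < (A.step τ s).size, (A.step τ s).cfg i = φ.last := by
  have hi := (PTree.nearest_spec hτ.size_pos s).1
  unfold step
  dsimp only
  rcases hφ : A.expLPlanning (τ.cfg (τ.nearest s))
    (A.uOL (τ.cfg (τ.nearest s)) (steerTarget A.η (τ.cfg (τ.nearest s)) s)) with _ | φ
  · exact ⟨hτ, PTree.Extends.refl τ, fun _ h => nomatch h⟩
  · dsimp only
    set l := τ.near (A.radius (τ.size + 1)) φ.last
    have hl : ∀ j ∈ l, j < τ.size := fun j hj => PTree.lt_size_of_mem_near hj
    obtain ⟨hb, hb'⟩ := chooseParent_spec hB hτ hl (b := (τ.nearest s, φ)) hi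
      (certifies_of_expLPlanning hB (hτ.mem _ hi) hφ)
    set b := A.chooseParent τ φ.last l (τ.nearest s, φ)
    have hlast : b.2.last = φ.last := hb'.last
    have hk : τ.size < (τ.addChild b.1 b.2).size := Nat.lt_succ_self _
    obtain ⟨hv, he⟩ := rewire_spec hB (hτ.addChild hb (hlast.symm ▸ hb')) hk
      (fun j hj => Nat.lt_succ_of_lt (hl j hj))
    obtain ⟨hv', he'⟩ := extToGoal_spec hB hv (hk.trans_le he.1)
    have hee := he.trans he'
    refine ⟨hv', (τ.extends_addChild b.1 b.2).trans hee, fun φ' h => ?_⟩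
    obtain rfl := Option.some.inj h
    exact ⟨τ.size, hk.trans_le hee.1,
      (hee.2 _ hk).trans ((τ.addChild_cfg_size b.1 b.2).trans hlast)⟩

theorem valid_tree (hB : A.B.IsHOCBF P) (hstart : P.qstart ∈ A.B.certified P) (s : ℕ → Cfg d)
    (N : ℕ) : (A.tree s N).Valid P A.B := by
  induction N with
  | zero => exact PTree.valid_root hstart
  | succ N ih => exact (step_spec hB ih (s N)).1

theorem steerTarget_eq_of_dist_le {η : ℝ} {v s : Cfg d} (h : dist v s ≤ η) :
    steerTarget η v s = s := by
  unfold steerTarget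
  split_ifs with hlt
  · rfl
  · have heq : ‖s - v‖ = η := le_antisymm (by rwa [← dist_eq_norm, dist_comm]) (not_lt.1 hlt)
    rcases eq_or_ne η 0 with h0 | h0
    · have : s - v = 0 := norm_eq_zero.1 (heq.trans h0)
      rw [this, smul_zero, add_zero]
      exact (sub_eq_zero.1 this).symm
    · rw [heq, div_self h0, one_smul, add_sub_cancel]

/-- A safe sample within the step size of the tree leads to a vertex within `μ` of it. -/
theorem exists_vertex_step_near_sample {μ : ℝ} (hB : A.B.IsHOCBF P)
    (hcert : A.B.certified P ⊆ P.Qsafe)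
    (hreach : ∀ x ∈ P.Qsafe, ∀ y ∈ P.Qsafe, dist x y ≤ A.η → P.Reachable x y)
    (htuned : ∀ x ∈ A.B.certified P, ∀ y ∈ P.Qsafe, dist x y ≤ A.η → P.Reachable x y →
      ∃ χ, A.expLPlanning x (A.uOL x y) = some χ ∧ dist χ.last y ≤ μ)
    (hτ : τ.Valid P A.B) {s : Cfg d} (hs : s ∈ P.Qsafe) {j : ℕ} (hj : j < τ.size)
    (hjs : dist (τ.cfg j) s ≤ A.η) :
    ∃ i < (A.step τ s).size, dist ((A.step τ s).cfg i) s ≤ μ := by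
  obtain ⟨hi, hmin⟩ := PTree.nearest_spec hτ.size_pos s
  have hd := (hmin j hj).trans hjs
  have hc := hτ.mem _ hi
  obtain ⟨χ, hχ, hχs⟩ := htuned _ hc s hs hd (hreach _ (hcert hc) s hs hd)
  obtain ⟨i, hi, hcfg⟩ := (step_spec hB hτ s).2.2 χ (by rwa [steerTarget_eq_of_dist_le hd])
  exact ⟨i, hi, hcfg ▸ hχs⟩

end Planner

/-! ### Passing through a chain of events -/

/-- Given events `S k n` (`n` is a time), the event that there are times
`n₀ < n₁ < … < n_{k-1} < N` at which `S 0 n₀, …, S (k - 1) n_{k-1}` occur. -/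
def passed {Ω : Type*} (S : ℕ → ℕ → Set Ω) : ℕ → ℕ → Set Ω
  | 0, _ => univ
  | _ + 1, 0 => ∅
  | k + 1, N + 1 => passed S (k + 1) N ∪ (passed S k N ∩ S k N)

section passed

variable {Ω : Type*} {S : ℕ → ℕ → Set Ω}

theorem monotone_passed (k : ℕ) : Monotone (passed S k) := by
  cases k with
  | zero =>
    intro N M _
    rw [passed, passed]
  | succ k =>
    refine monotone_nat_of_le_succ fun N => ?_
    conv_rhs => rw [passed]
    exact subset_union_left

theorem measurableSet_passed [MeasurableSpace Ω] (hS : ∀ k n, MeasurableSet (S k n)) (k N : ℕ) :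
    MeasurableSet (passed S k N) := by
  induction N generalizing k with
  | zero => cases k <;> simp [passed]
  | succ N ih =>
    cases k with
    | zero => simp [passed]
    | succ k =>
      rw [passed]
      exact (ih _).union ((ih _).inter (hS k N))

theorem exists_mem_passed {ω : Ω} {K : ℕ} (h : ∀ k < K, ∃ᶠ n in atTop, ω ∈ S k n) :
    ∃ N, ω ∈ passed S K N := by
  induction K with
  | zero => exact ⟨0, by simp [passed]⟩
  | succ K ih =>
    obtain ⟨N, hN⟩ := ih fun k hk => h k (by omega)
    obtain ⟨n, hn, hω⟩ := (frequently_atTop.1 (h K (by omega))) N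
    refine ⟨n + 1, ?_⟩
    rw [passed]
    exact Or.inr ⟨monotone_passed K hn hN, hω⟩

end passed

theorem ae_frequently_mem_of_iIndepFun {Ω E : Type*} [MeasurableSpace Ω] [MeasurableSpace E]
    {Pr : Measure Ω} {X : ℕ → Ω → E} (hmeas : ∀ n, Measurable (X n))
    (hind : iIndepFun X Pr) {R : Set E} (hR : MeasurableSet R) {c : ℝ≥0∞} (hc : c ≠ 0)
    (hX : ∀ n, Pr (X n ⁻¹' R) = c) : ∀ᵐ ω ∂Pr, ∃ᶠ n in atTop, X n ω ∈ R := by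
  have hS : ∀ n, MeasurableSet (X n ⁻¹' R) := fun n => hmeas n hR
  have hi : iIndepSet (fun n => X n ⁻¹' R) Pr :=
    (iIndepSet_iff_meas_biInter hS).2 fun s =>
      (iIndepFun_iff_measure_inter_preimage_eq_mul.1 hind) s fun _ _ => hR
  have := hi.isProbabilityMeasure
  have h1 := measure_limsup_eq_one hS hi (by simp [hX, hc])
  have h2 := (prob_compl_eq_zero_iff (MeasurableSet.measurableSet_limsup hS)).2 h1
  filter_upwards [compl_mem_ae_iff.2 h2] with ω hω
  rw [compl_compl] at hω
  exact mem_limsup_iff_frequently_mem.1 hω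

theorem pdf.IsUniform.measure_preimage_ne_zero {Ω E : Type*} [MeasurableSpace Ω]
    [MeasurableSpace E] {Pr : Measure Ω} {ν : Measure E} {X : Ω → E} {Q R : Set E}
    (hX : Measurable X) (hu : pdf.IsUniform X Q Pr ν) (hQ : ν Q ≠ ∞) (hR : MeasurableSet R)
    (hRQ : R ⊆ Q) (hR0 : ν R ≠ 0) : Pr (X ⁻¹' R) ≠ 0 := by
  rw [← Measure.map_apply hX hR, hu, cond_apply' hR, inter_eq_self_of_subset_right hRQ]
  exact mul_ne_zero (ENNReal.inv_ne_zero.2 hQ) hR0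

/-- A continuous curve on `[0, T]` has a finite chain of points with spacing at most `δ` that
leads from its start to its end. -/
theorem exists_chain_of_continuousOn {E : Type*} [PseudoMetricSpace E] {q : ℝ → E} {T δ : ℝ}
    (hT : 0 ≤ T) (hq : ContinuousOn q (Icc 0 T)) (hδ : 0 < δ) :
    ∃ (K : ℕ) (t : ℕ → ℝ), t 0 = 0 ∧ t K = T ∧ (∀ k ≤ K, t k ∈ Icc 0 T) ∧
      ∀ k < K, dist (q (t k)) (q (t (k + 1))) ≤ δ := by
  obtain ⟨r, hr, h⟩ := Metric.uniformContinuousOn_iff.1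
    (isCompact_Icc.uniformContinuousOn_of_continuous hq) δ hδ
  obtain ⟨n, hn⟩ := exists_nat_gt (T / r)
  have hn0 : (0 : ℝ) < n := (div_nonneg hT hr.le).trans_lt hn
  have hstep : T / n < r := by rwa [div_lt_comm₀ hn0 hr]
  have hmem : ∀ k ≤ n, (k : ℝ) * (T / n) ∈ Icc 0 T := fun k hk => by
    refine ⟨by positivity, ?_⟩
    calc (k : ℝ) * (T / n) ≤ n * (T / n) := by gcongr
      _ = T := by field_simp
  refine ⟨n, fun k => k * (T / n), by simp, by field_simp, hmem, fun k hk => ?_⟩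
  refine (h _ (hmem k hk.le) _ (hmem (k + 1) hk) ?_).le
  rw [Real.dist_eq, abs_sub_comm, abs_of_nonneg]
  · push_cast
    linarith
  · push_cast
    have := div_nonneg hT hn0.le
    linarith

/-- If the measure of an increasing sequence of measurable events tends to that of an almost sure
event, then larger events, measurable or not, have measure tending to `1` and complements of outer
measure tending to `0`. -/
theorem tendsto_measure_of_monotone_subset {Ω : Type*} [MeasurableSpace Ω] {Pr : Measure Ω}
    [IsProbabilityMeasure Pr] {F G : ℕ → Set Ω} (hF : ∀ N, MeasurableSet (F N))
    (hmono : Monotone F) (hFG : ∀ N, F N ⊆ G N) (hae : ∀ᵐ ω ∂Pr, ∃ N, ω ∈ F N) :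
    Tendsto (fun N => Pr (G N)) atTop (𝓝 1) ∧ Tendsto (fun N => Pr (G N)ᶜ) atTop (𝓝 0) := by
  have h1 : Pr (⋃ N, F N) = 1 := by
    rw [← prob_compl_eq_zero_iff (MeasurableSet.iUnion hF)]
    refine measure_mono_null (fun ω hω => ?_) (ae_iff.1 hae)
    simpa using hω
  have hlim := tendsto_measure_iUnion_atTop (μ := Pr) hmono
  rw [h1] at hlim
  constructor
  · exact tendsto_of_tendsto_of_tendsto_of_le_of_le hlim tendsto_const_nhds
      (fun N => measure_mono (hFG N)) fun N => prob_le_one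
  · have hsub := ENNReal.Tendsto.sub (tendsto_const_nhds (x := (1 : ℝ≥0∞))) hlim
      (Or.inl ENNReal.one_ne_top)
    rw [tsub_self] at hsub
    refine tendsto_of_tendsto_of_tendsto_of_le_of_le tendsto_const_nhds hsub
      (fun N => zero_le) fun N => ?_
    refine (measure_mono (compl_subset_compl.2 (hFG N))).trans ?_
    rw [prob_compl_eq_one_sub (hF N)]
    rfl

/-- CBF-RRT* is probabilistically complete. Measurability of the planner in the sample is not
assumed; the second limit, which is about an outer probability, is then the stronger form. -/
theorem mainTheorem1 {d m : ℕ} (P : PlanningProblem d m) (hP : P.Standing) (A : Planner P)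
    (ε μ ι : ℝ) (hμ : 0 < μ) (hμε : μ < ε / 4) (hι : 0 < ι) (hιε : ι < ε / 4 - μ)
    (hη : A.η = ε / 4 + μ + 2 * ι) (hlam : 0 < A.lam)
    -- the barrier function certifies safety, also of the start configuration
    (hB : A.B.IsHOCBF P) (hcert : A.B.certified P ⊆ P.Qsafe)
    (hstart : P.qstart ∈ A.B.certified P)
    -- robust feasibility, the end of the path lying inside the goal region
    (φ : Motion d m) (hφ : φ ∈ P.solutions) (hclear : P.HasClearance φ ε)
    (hgoal : ∃ r > μ, Metric.closedBall φ.last r ∩ P.Qsafe ⊆ P.Qgoal)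
    -- open-loop steering
    (hOL : ∀ x ∈ P.Q, ∀ y ∈ P.Q, P.Reachable x y → (A.uOL x y).Steers P x y)
    (hreach : ∀ x ∈ P.Qsafe, ∀ y ∈ P.Qsafe, dist x y ≤ A.η → P.Reachable x y)
    -- the barrier function is tuned
    (htuned : ∀ x ∈ A.B.certified P, ∀ y ∈ P.Qsafe, dist x y ≤ A.η → P.Reachable x y →
      ∃ χ, A.expLPlanning x (A.uOL x y) = some χ ∧ dist χ.last y ≤ μ)
    -- independent uniform samples
    {Ω : Type*} [MeasurableSpace Ω] (Pr : Measure Ω) [IsProbabilityMeasure Pr]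
    (X : ℕ → Ω → Cfg d) (hmeas : ∀ k, Measurable (X k)) (hind : iIndepFun X Pr)
    (hunif : ∀ k, pdf.IsUniform (X k) P.Q Pr volume) :
    Tendsto (fun N => Pr {ω | (A.tree (fun k => X k ω) N).HasSolution P}) atTop (𝓝 1) ∧
      Tendsto (fun N => Pr {ω | ¬ (A.tree (fun k => X k ω) N).HasSolution P}) atTop (𝓝 0) := by
  obtain ⟨hm, hq0, -, -⟩ := hφ
  obtain ⟨r, hr, hgoal⟩ := hgoal
  obtain ⟨K, t, ht0, htK, ht, hstep⟩ :=
    exists_chain_of_continuousOn hm.T_nonneg hm.cont (show 0 < ε / 4 by linarith)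
  set r₀ := min ι (r - μ)
  have hr₀_pos : 0 < r₀ := lt_min hι (by linarith)
  have hr₀ι : r₀ ≤ ι := min_le_left _ _
  have hr₀r : r₀ ≤ r - μ := min_le_right _ _
  let R : ℕ → Set (Cfg d) := fun k => Metric.ball (φ.q (t (k + 1))) r₀ ∩ interior P.Q
  have hR_open : ∀ k, IsOpen (R k) := fun k => Metric.isOpen_ball.inter isOpen_interior
  have hR_safe : ∀ k < K, R k ⊆ P.Qsafe := by
    intro k hk s hs
    by_contra hns
    have h1 := hclear _ (ht (k + 1) hk) s ⟨interior_subset hs.2, hns⟩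
    have h2 : dist s (φ.q (t (k + 1))) < r₀ := hs.1
    rw [dist_comm] at h2
    linarith
  have hR_ne : ∀ k < K, volume (R k) ≠ 0 := by
    intro k hk
    have hmem := hP.Q_regular (hm.mem_Q _ (ht (k + 1) hk))
    exact ((hR_open k).measure_pos volume (mem_closure_iff.1 hmem _ Metric.isOpen_ball
      (Metric.mem_ball_self hr₀_pos))).ne'
  let S : ℕ → ℕ → Set Ω := fun k n => X n ⁻¹' R k
  have hvalid := fun ω N => Planner.valid_tree hB hstart (fun n => X n ω) N
  have hnear : ∀ ω N, ∀ k ≤ K, ω ∈ passed S k N →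
      ∃ i < (A.tree (fun n => X n ω) N).size,
        dist ((A.tree (fun n => X n ω) N).cfg i) (φ.q (t k)) ≤ μ + r₀ := by
    intro ω N
    induction N with
    | zero =>
      intro k _ hω
      cases k with
      | zero =>
        refine ⟨0, Nat.one_pos, ?_⟩
        rw [ht0, hq0]
        show dist P.qstart P.qstart ≤ _
        rw [dist_self]
        linarith
      | succ k => simp [passed] at hω
    | succ N ih =>
      have hkeep : ∀ k, (∃ i < (A.tree (fun n => X n ω) N).size,
          dist ((A.tree (fun n => X n ω) N).cfg i) (φ.q (t k)) ≤ μ + r₀) →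
          ∃ i < (A.tree (fun n => X n ω) (N + 1)).size,
            dist ((A.tree (fun n => X n ω) (N + 1)).cfg i) (φ.q (t k)) ≤ μ + r₀ := by
        rintro k ⟨i, hi, hd⟩
        have he := (Planner.step_spec hB (hvalid ω N) (X N ω)).2.1
        exact ⟨i, hi.trans_le he.1, (he.2 i hi).symm ▸ hd⟩
      intro k hk hω
      cases k with
      | zero => exact hkeep 0 (ih 0 hk (by simp [passed]))
      | succ k =>
        rw [passed] at hω
        rcases hω with hω | ⟨hω, hs⟩
        · exact hkeep _ (ih _ hk hω)
        · obtain ⟨j, hj, hd⟩ := ih k (by omega) hω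
          have hs1 : dist (X N ω) (φ.q (t (k + 1))) < r₀ := hs.1
          have hs2 := hstep k hk
          have hjs : dist ((A.tree (fun n => X n ω) N).cfg j) (X N ω) ≤ A.η := by
            have h1 := dist_triangle4 ((A.tree (fun n => X n ω) N).cfg j) (φ.q (t k))
              (φ.q (t (k + 1))) (X N ω)
            rw [dist_comm (φ.q (t (k + 1))) (X N ω)] at h1
            linarith
          obtain ⟨i, hi, hd'⟩ := Planner.exists_vertex_step_near_sample hB hcert hreach htuned
            (hvalid ω N) (hR_safe k hk hs) hj hjs
          exact ⟨i, hi, (dist_triangle _ (X N ω) _).trans (add_le_add hd' hs1.le)⟩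
  refine tendsto_measure_of_monotone_subset (F := passed S K)
    (measurableSet_passed (fun k n => hmeas n (hR_open k).measurableSet) K) (monotone_passed K)
    (fun N ω hω => ?_) ?_
  · obtain ⟨i, hi, hd⟩ := hnear ω N K le_rfl hω
    rw [htK] at hd
    refine (hvalid ω N).hasSolution hcert hi (hgoal ⟨?_, hcert ((hvalid ω N).mem i hi)⟩)
    rw [Metric.mem_closedBall]
    exact hd.trans (by linarith)
  · have h : ∀ k < K, ∀ᵐ ω ∂Pr, ∃ᶠ n in atTop, ω ∈ S k n := by
      intro k hk
      refine ae_frequently_mem_of_iIndepFun hmeas hind (hR_open k).measurableSet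
        (c := Pr (X 0 ⁻¹' R k)) ?_ fun n => ?_
      · exact pdf.IsUniform.measure_preimage_ne_zero (hmeas 0) (hunif 0) hP.Q_finite.ne
          (hR_open k).measurableSet (inter_subset_right.trans interior_subset) (hR_ne k hk)
      · rw [← Measure.map_apply (hmeas n) (hR_open k).measurableSet, hunif n, ← hunif 0,
          Measure.map_apply (hmeas 0) (hR_open k).measurableSet]
    have h' : ∀ᵐ ω ∂Pr, ∀ k, k < K → ∃ᶠ n in atTop, ω ∈ S k n :=
      by
      refine ae_all_iff.2 fun k => ?_
      by_cases hk : k < K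
      · exact (h k hk).mono fun _ hω _ => hω
      · exact Eventually.of_forall fun _ hk' => absurd hk' hk
    exact h'.mono fun ω hω => exists_mem_passed hω
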